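/- A tensor triangulated category is a triangulated category $(\mathcal K,\Sigma)$ with a symmetric monoidal structure $(\otimes,\mathbb 1)$ such that $a\otimes-$ and $-\otimes a$ are exact for every object $a$, where the suspension isomorphisms $\Sigma a\otimes b\simeq\Sigma(a\otimes b)\simeq a\otimes\Sigma b$ are natural, compatible with the symmetry, unitors and associator, and the two resulting identifications $\Sigma a\otimes\Sigma b\simeq\Sigma^2(a\otimes b)$ differ by the sign $-1$. A tensor triangulated functor is an exact functor that is also strong monoidal, with structure isomorphisms compatible with the suspension isomorphisms. The spectrum $\mathrm{Spc}(\mathcal K)$ is the set of prime ideals of $\mathcal K$, i.e. of proper thick $\otimes$-ideals $\mathcal P$ such that $a\otimes b\in\mathcal P$ implies $a\in\mathcal P$ or $b\in\mathcal P$. Its topology has the sets $\mathrm{supp}(a)=\{\mathcal P\mid a\notin\mathcal P\}$, $a\in\mathcal K$, as a basis of closed sets. Let $\Phi$ be a non-empty set of objects of $\mathcal K$ with $a\otimes b\in\Phi$ for all $a,b\in\Phi$. Put $\mathcal Z_{\mathcal K,\Phi}=\bigcap_{X\in\Phi}\mathrm{supp}(X)\subset\mathrm{Spc}(\mathcal K)$.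 For an object $X$ let $E_X=\{f\in\mathrm{End}(X)\mid f\otimes X=X\otimes f\}$. Let $R_{\mathcal K,\Phi}$ be the set of pairs $(X,f)$ with $X\in\Phi$ and $f\in E_X$, modulo the smallest equivalence relation such that $(X,f)\sim(a\otimes X,a\otimes f)$ and $(X,f)\sim(X\otimes a,f\otimes a)$ for all $a\in\Phi$. It is a commutative ring with $[f_X]+[g_Y]=[f\otimes Y+X\otimes g]$ and $[f_X]\cdot[g_Y]=[(f\otimes Y)\circ(X\otimes g)]$. **Proposition.** Let $F:\mathcal K\to\mathcal L$ be a tensor triangulated functor, and let $\Phi\subset\mathcal K$, $\Psi\subset\mathcal L$ be non-empty sets of objects closed under $\otimes$ with $F(\Phi)\subset\Psi$. Then $[f]\mapsto[F(f)]$ is a well-defined ring homomorphism $\varphi:R_{\mathcal K,\Phi}\to R_{\mathcal L,\Psi}$; the rules $$\mathrm{Spc}(F)(\mathcal P)=F^{-1}(\mathcal P),\qquad \rho_{\mathcal K,\Phi}(\mathcal P)=\{[f]\mid \mathrm{cone}(f)\notin\mathcal P\},\qquad \rho_{\mathcal L,\Psi}(\mathcal P)=\{[g]\mid \mathrm{cone}(g)\notin\mathcal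 P\}$$ give well-defined maps $\mathrm{Spc}(F):\mathrm{Spc}(\mathcal L)\to\mathrm{Spc}(\mathcal K)$, $\rho_{\mathcal K,\Phi}:\mathcal Z_{\mathcal K,\Phi}\to\mathrm{Spec}(R_{\mathcal K,\Phi})$ and $\rho_{\mathcal L,\Psi}:\mathcal Z_{\mathcal L,\Psi}\to\mathrm{Spec}(R_{\mathcal L,\Psi})$ (the conditions on cones being independent of the chosen representatives); $\mathrm{Spc}(F)$ restricts to a map $\mathcal Z_{\mathcal L,\Psi}\to\mathcal Z_{\mathcal K,\Phi}$; and the square $$\begin{array}{ccc}\mathcal Z_{\mathcal L,\Psi}&\xrightarrow{\ \rho_{\mathcal L,\Psi}\ }&\mathrm{Spec}(R_{\mathcal L,\Psi})\\ {\scriptstyle \mathrm{Spc}(F)}\big\downarrow&&\big\downarrow{\scriptstyle \mathrm{Spec}(\varphi)}\\ \mathcal Z_{\mathcal K,\Phi}&\xrightarrow{\ \rho_{\mathcal K,\Phi}\ }&\mathrm{Spec}(R_{\mathcal K,\Phi})\end{array}$$ commutes. The whole diagram, including the inclusions $\mathcal Z_{\mathcal L,\Psi}\subset\mathrm{Spc}(\mathcal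 L)$ and $\mathcal Z_{\mathcal K,\Phi}\subset\mathrm{Spc}(\mathcal K)$, lies in the category of spectral spaces: all six spaces are spectral and all seven maps are spectral maps. -/

import Mathlib

open CategoryTheory CategoryTheory.Limits CategoryTheory.MonoidalCategory
open CategoryTheory.Pretriangulated

universe v₁ v₂ u₁ u₂ v u

namespace TensorTriangular

/-! ### Tensor triangulated categories -/

section TTCategory

/-- A tensor triangulated category: a triangulated category with a symmetric monoidal structure,
together with suspension isomorphisms `a⟦n⟧ ⊗ b ≅ (a ⊗ b)⟦n⟧` and `a ⊗ b⟦n⟧ ≅ (a ⊗ b)⟦n⟧`,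
natural in both variables, such that the two ways of identifying `a⟦1⟧ ⊗ b⟦1⟧` with
`(a ⊗ b)⟦1⟧⟦1⟧` differ by the sign `-1` (all this is `Functor.CommShift₂Int` for the tensor
bifunctor), such that `a ⊗ -` and `- ⊗ a` are exact functors, and such that the suspension
isomorphisms are compatible with the symmetry, the unitors and the associator. -/
class TensorTriangulatedCategory (K : Type u) [Category.{v} K] [Preadditive K] [HasZeroObject K]
    [HasShift K ℤ] [∀ n : ℤ, (shiftFunctor K n).Additive] [Pretriangulated K]
    [MonoidalCategory K] [SymmetricCategory K] where
  isTriangulated : IsTriangulated K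
  commShift : (curriedTensor K).CommShift₂Int
  tensorLeft_isTriangulated (a : K) : (tensorLeft a).IsTriangulated
  tensorRight_isTriangulated (a : K) : (tensorRight a).IsTriangulated
  shift_braiding (a b : K) :
    ((tensorRight b).commShiftIso (1 : ℤ)).hom.app a ≫ (β_ a b).hom⟦(1 : ℤ)⟧' =
      (β_ (a⟦(1 : ℤ)⟧) b).hom ≫ ((tensorLeft b).commShiftIso (1 : ℤ)).hom.app a
  shift_leftUnitor (a : K) :
    ((tensorLeft (𝟙_ K)).commShiftIso (1 : ℤ)).hom.app a ≫ (λ_ a).hom⟦(1 : ℤ)⟧' =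
      (λ_ (a⟦(1 : ℤ)⟧)).hom
  shift_rightUnitor (a : K) :
    ((tensorRight (𝟙_ K)).commShiftIso (1 : ℤ)).hom.app a ≫ (ρ_ a).hom⟦(1 : ℤ)⟧' =
      (ρ_ (a⟦(1 : ℤ)⟧)).hom
  shift_associator_left (a b c : K) :
    ((tensorRight b).commShiftIso (1 : ℤ)).hom.app a ▷ c ≫
        ((tensorRight c).commShiftIso (1 : ℤ)).hom.app (a ⊗ b) ≫ (α_ a b c).hom⟦(1 : ℤ)⟧' =
      (α_ (a⟦(1 : ℤ)⟧) b c).hom ≫ ((tensorRight (b ⊗ c)).commShiftIso (1 : ℤ)).hom.app a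
  shift_associator_middle (a b c : K) :
    ((tensorLeft a).commShiftIso (1 : ℤ)).hom.app b ▷ c ≫
        ((tensorRight c).commShiftIso (1 : ℤ)).hom.app (a ⊗ b) ≫ (α_ a b c).hom⟦(1 : ℤ)⟧' =
      (α_ a (b⟦(1 : ℤ)⟧) c).hom ≫ a ◁ ((tensorRight c).commShiftIso (1 : ℤ)).hom.app b ≫
        ((tensorLeft a).commShiftIso (1 : ℤ)).hom.app (b ⊗ c)
  shift_associator_right (a b c : K) :
    ((tensorLeft (a ⊗ b)).commShiftIso (1 : ℤ)).hom.app c ≫ (α_ a b c).hom⟦(1 : ℤ)⟧' =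
      (α_ a b (c⟦(1 : ℤ)⟧)).hom ≫ a ◁ ((tensorLeft b).commShiftIso (1 : ℤ)).hom.app c ≫
        ((tensorLeft a).commShiftIso (1 : ℤ)).hom.app (b ⊗ c)

attribute [reducible, instance] TensorTriangulatedCategory.commShift
attribute [instance] TensorTriangulatedCategory.isTriangulated
  TensorTriangulatedCategory.tensorLeft_isTriangulated
  TensorTriangulatedCategory.tensorRight_isTriangulated

/-- Exact functors are additive, so the tensor product is additive in each variable. -/
instance monoidalPreadditive (K : Type u) [Category.{v} K] [Preadditive K] [HasZeroObject K]
    [HasShift K ℤ] [∀ n : ℤ, (shiftFunctor K n).Additive] [Pretriangulated K]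
    [MonoidalCategory K] [SymmetricCategory K] [TensorTriangulatedCategory K] :
    MonoidalPreadditive K where
  whiskerLeft_zero {X _ _} := (tensorLeft X).map_zero _ _
  zero_whiskerRight {X _ _} := (tensorRight X).map_zero _ _
  whiskerLeft_add {X _ _} f g := (tensorLeft X).map_add (f := f) (g := g)
  add_whiskerRight {X _ _} f g := (tensorRight X).map_add (f := f) (g := g)

open Functor.LaxMonoidal in
/-- A tensor triangulated functor: an exact functor (with its isomorphisms
`F (a⟦n⟧) ≅ (F a)⟦n⟧`) that is also a strong monoidal functor (with its isomorphisms
`F a ⊗ F b ≅ F (a ⊗ b)` and `𝟙 ≅ F 𝟙`), such that these isomorphisms are compatible with the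
suspension isomorphisms of the two categories. -/
class IsTensorTriangulated {K : Type u₁} {L : Type u₂}
    [Category.{v₁} K] [Preadditive K] [HasZeroObject K] [HasShift K ℤ]
    [∀ n : ℤ, (shiftFunctor K n).Additive] [Pretriangulated K]
    [MonoidalCategory K] [SymmetricCategory K] [TensorTriangulatedCategory K]
    [Category.{v₂} L] [Preadditive L] [HasZeroObject L] [HasShift L ℤ]
    [∀ n : ℤ, (shiftFunctor L n).Additive] [Pretriangulated L]
    [MonoidalCategory L] [SymmetricCategory L] [TensorTriangulatedCategory L]
    (F : K ⥤ L) [F.CommShift ℤ] [F.Monoidal] : Prop where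
  isTriangulated : F.IsTriangulated
  shift_tensorRight (a b : K) :
    (F.commShiftIso (1 : ℤ)).hom.app a ▷ F.obj b ≫
        ((tensorRight (F.obj b)).commShiftIso (1 : ℤ)).hom.app (F.obj a) ≫ (μ F a b)⟦(1 : ℤ)⟧' =
      μ F (a⟦(1 : ℤ)⟧) b ≫ F.map (((tensorRight b).commShiftIso (1 : ℤ)).hom.app a) ≫
        (F.commShiftIso (1 : ℤ)).hom.app (a ⊗ b)
  shift_tensorLeft (a b : K) :
    F.obj a ◁ (F.commShiftIso (1 : ℤ)).hom.app b ≫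
        ((tensorLeft (F.obj a)).commShiftIso (1 : ℤ)).hom.app (F.obj b) ≫ (μ F a b)⟦(1 : ℤ)⟧' =
      μ F a (b⟦(1 : ℤ)⟧) ≫ F.map (((tensorLeft a).commShiftIso (1 : ℤ)).hom.app b) ≫
        (F.commShiftIso (1 : ℤ)).hom.app (a ⊗ b)

end TTCategory

/-! ### The spectrum -/

section Spectrum

variable (K : Type u) [Category.{v} K] [Preadditive K] [HasZeroObject K] [HasShift K ℤ]
  [∀ n : ℤ, (shiftFunctor K n).Additive] [Pretriangulated K] [MonoidalCategory K]

variable {K} in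
/-- The (chosen) cone of a morphism `f`, i.e. the third object of a distinguished triangle
`X ⟶ Y ⟶ cone f ⟶ X⟦1⟧` on `f`; it is well defined up to isomorphism. -/
noncomputable def cone {X Y : K} (f : X ⟶ Y) : K :=
  (distinguished_cocone_triangle f).choose

variable {K} in
/-- Prime (thick tensor) ideals: proper full triangulated subcategories `P`, closed under direct
summands and under tensoring with arbitrary objects, such that `a ⊗ b ∈ P` implies `a ∈ P` or
`b ∈ P`. -/
structure IsPrimeTensorIdeal (P : ObjectProperty K) : Prop where
  isTriangulated : P.IsTriangulated
  isStableUnderRetracts : P.IsStableUnderRetracts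
  tensor_mem (a b : K) : P b → P (a ⊗ b)
  ne_top : P ≠ ⊤
  mem_or_mem (a b : K) : P (a ⊗ b) → P a ∨ P b

/-- The spectrum `Spc K`: the set of prime thick tensor ideals of `K`. -/
@[ext]
structure Spc where
  asIdeal : ObjectProperty K
  isPrime : IsPrimeTensorIdeal asIdeal

variable {K}

/-- `supp a = {P ∈ Spc K | a ∉ P}`. -/
def supp (a : K) : Set (Spc K) := {P | ¬ P.asIdeal a}

/-- The Balmer topology, for which the sets `supp a` are a basis of closed sets. -/
instance : TopologicalSpace (Spc K) :=
  TopologicalSpace.generateFrom (Set.range fun a : K => (supp a)ᶜ)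

end Spectrum

/-! ### The ring attached to a tensor-multiplicative set of objects -/

section Ring

section Swap

variable {K : Type u} [Category.{v} K] [MonoidalCategory K] [SymmetricCategory K]

/-- The isomorphism `(X ⊗ a) ⊗ Y ≅ (X ⊗ Y) ⊗ a`. -/
def swapRight (X a Y : K) : (X ⊗ a) ⊗ Y ≅ (X ⊗ Y) ⊗ a :=
  α_ X a Y ≪≫ whiskerLeftIso X (β_ a Y) ≪≫ (α_ X Y a).symm

/-- The isomorphism `X ⊗ (a ⊗ Y) ≅ a ⊗ (X ⊗ Y)`. -/
def swapLeft (X a Y : K) : X ⊗ (a ⊗ Y) ≅ a ⊗ (X ⊗ Y) :=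
  (α_ X a Y).symm ≪≫ whiskerRightIso (β_ X a) Y ≪≫ α_ a X Y

theorem swapRight_left {X : K} (f : X ⟶ X) (a Y : K) :
    (f ▷ a) ▷ Y ≫ (swapRight X a Y).hom = (swapRight X a Y).hom ≫ (f ▷ Y) ▷ a := by
  simp only [swapRight, Iso.trans_hom, whiskerLeftIso_hom, Iso.symm_hom, Category.assoc,
    associator_naturality_left_assoc, ← whisker_exchange_assoc, associator_inv_naturality_left]

theorem swapRight_right (X a : K) {Y : K} (g : Y ⟶ Y) :
    (X ⊗ a) ◁ g ≫ (swapRight X a Y).hom = (swapRight X a Y).hom ≫ (X ◁ g) ▷ a := by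
  simp only [swapRight, Iso.trans_hom, whiskerLeftIso_hom, Iso.symm_hom, Category.assoc,
    associator_naturality_right_assoc, ← MonoidalCategory.whiskerLeft_comp_assoc,
    BraidedCategory.braiding_naturality_right, MonoidalCategory.whiskerLeft_comp,
    associator_inv_naturality_middle]

theorem swapLeft_left {X : K} (f : X ⟶ X) (a Y : K) :
    f ▷ (a ⊗ Y) ≫ (swapLeft X a Y).hom = (swapLeft X a Y).hom ≫ a ◁ (f ▷ Y) := by
  simp only [swapLeft, Iso.trans_hom, whiskerRightIso_hom, Iso.symm_hom, Category.assoc,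
    associator_inv_naturality_left_assoc, ← comp_whiskerRight_assoc,
    BraidedCategory.braiding_naturality_left]
  simp only [comp_whiskerRight, Category.assoc, associator_naturality_middle]

theorem swapLeft_right (X a : K) {Y : K} (g : Y ⟶ Y) :
    X ◁ (a ◁ g) ≫ (swapLeft X a Y).hom = (swapLeft X a Y).hom ≫ a ◁ (X ◁ g) := by
  simp only [swapLeft, Iso.trans_hom, whiskerRightIso_hom, Iso.symm_hom, Category.assoc,
    associator_inv_naturality_right_assoc, whisker_exchange_assoc, associator_naturality_right]

end Swap

/-- A non-empty set of objects that is closed under the tensor product. -/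
structure TensorMultiplicativeSet (K : Type u) [Category.{v} K] [MonoidalCategory K] where
  carrier : Set K
  nonempty : carrier.Nonempty
  tensor_mem {a b : K} : a ∈ carrier → b ∈ carrier → a ⊗ b ∈ carrier

/-- `Z_Φ = ⋂_{X ∈ Φ} supp X`. -/
def TensorMultiplicativeSet.zeroLocus {K : Type u} [Category.{v} K] [Preadditive K]
    [HasZeroObject K] [HasShift K ℤ] [∀ n : ℤ, (shiftFunctor K n).Additive] [Pretriangulated K]
    [MonoidalCategory K] (Φ : TensorMultiplicativeSet K) : Set (Spc K) :=
  ⋂ X ∈ Φ.carrier, supp X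

variable {K : Type u} [Category.{v} K] [Preadditive K] [MonoidalCategory K]
  [MonoidalPreadditive K]

/-- The ring `E_X` of tensor-balanced endomorphisms of `X`: those `f` with
`f ⊗ X = X ⊗ f` as endomorphisms of `X ⊗ X`. -/
def balancedEnd (X : K) : Subring (End X) where
  carrier := {f | (show X ⟶ X from f) ▷ X = X ◁ (show X ⟶ X from f)}
  mul_mem' {f g} hf hg := by
    simp only [Set.mem_ofPred_eq, End.mul_def] at *
    rw [comp_whiskerRight, MonoidalCategory.whiskerLeft_comp, hf, hg]
  one_mem' := by simp [End.one_def]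
  add_mem' {f g} hf hg := by
    simp only [Set.mem_ofPred_eq] at *
    rw [MonoidalPreadditive.add_whiskerRight, MonoidalPreadditive.whiskerLeft_add, hf, hg]
  zero_mem' := by simp
  neg_mem' {f} hf := by
    have h1 := (tensorRight X).map_neg (f := (show X ⟶ X from f))
    have h2 := (tensorLeft X).map_neg (f := (show X ⟶ X from f))
    simp only [Set.mem_ofPred_eq] at *
    exact h1.trans ((congrArg (fun t => -t) hf).trans h2.symm)

theorem mem_balancedEnd {X : K} (f : X ⟶ X) : f ∈ balancedEnd X ↔ f ▷ X = X ◁ f := Iff.rfl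

variable [SymmetricCategory K]

theorem whiskerRight_mem {X : K} (f : X ⟶ X) (hf : f ∈ balancedEnd X) (Y : K) :
    f ▷ Y ∈ balancedEnd (X ⊗ Y) := by
  rw [mem_balancedEnd] at *
  have h1 := tensorμ_natural f (𝟙 Y) (𝟙 X) (𝟙 Y)
  have h2 := tensorμ_natural (𝟙 X) (𝟙 Y) f (𝟙 Y)
  have : Mono (tensorμ X Y X Y) := mono_of_mono_fac (tensorμ_tensorδ X Y X Y)
  rw [← cancel_mono (tensorμ X Y X Y)]
  simp only [tensorHom_id, id_tensorHom, id_whiskerRight] at h1 h2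
  rw [h1, h2, hf]

theorem whiskerLeft_mem (X : K) {Y : K} (g : Y ⟶ Y) (hg : g ∈ balancedEnd Y) :
    X ◁ g ∈ balancedEnd (X ⊗ Y) := by
  rw [mem_balancedEnd] at *
  have h1 := tensorμ_natural (𝟙 X) g (𝟙 X) (𝟙 Y)
  have h2 := tensorμ_natural (𝟙 X) (𝟙 Y) (𝟙 X) g
  have : Mono (tensorμ X Y X Y) := mono_of_mono_fac (tensorμ_tensorδ X Y X Y)
  rw [← cancel_mono (tensorμ X Y X Y)]
  simp only [tensorHom_id, id_tensorHom, id_whiskerRight] at h1 h2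
  rw [h1, h2, hg]

variable (Φ : TensorMultiplicativeSet K)

/-- Pairs `(X, f)` with `X ∈ Φ` and `f ∈ E_X`. -/
structure Rep where
  obj : K
  mem : obj ∈ Φ.carrier
  endo : balancedEnd obj

variable {Φ} in
/-- The representative given by an endomorphism known to be balanced. -/
def Rep.of {X : K} (hX : X ∈ Φ.carrier) (f : X ⟶ X) (hf : f ∈ balancedEnd X) : Rep Φ :=
  ⟨X, hX, ⟨f, hf⟩⟩

variable {Φ} in
/-- The underlying endomorphism of a representative, as a morphism. -/
def Rep.hom (r : Rep Φ) : r.obj ⟶ r.obj := (r.endo : End r.obj)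

variable {Φ} in
theorem Rep.hom_mem (r : Rep Φ) : r.hom ∈ balancedEnd r.obj := r.endo.2

/-- The relations `(X, f) ∼ (a ⊗ X, a ⊗ f)` and `(X, f) ∼ (X ⊗ a, f ⊗ a)` for `a ∈ Φ`. -/
inductive RingRel : Rep Φ → Rep Φ → Prop
  | whiskerLeft (r : Rep Φ) (a : K) (ha : a ∈ Φ.carrier) :
      RingRel r (Rep.of (Φ.tensor_mem ha r.mem) (a ◁ r.hom) (whiskerLeft_mem a _ r.hom_mem))
  | whiskerRight (r : Rep Φ) (a : K) (ha : a ∈ Φ.carrier) :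
      RingRel r (Rep.of (Φ.tensor_mem r.mem ha) (r.hom ▷ a) (whiskerRight_mem _ r.hom_mem a))

/-- `R_Φ`: the quotient of the set of pairs `(X, f)` by the equivalence relation generated
by `RingRel`. -/
def R : Type (max u v) := Quot (RingRel Φ)

namespace R

variable {Φ}

/-- The class `[f_X]` of a balanced endomorphism `f` of `X ∈ Φ`. -/
def mk {X : K} (hX : X ∈ Φ.carrier) (f : balancedEnd X) : R Φ := Quot.mk _ ⟨X, hX, f⟩

theorem ind {p : R Φ → Prop} (h : ∀ (X : K) (hX : X ∈ Φ.carrier) (f : balancedEnd X), p (mk hX f))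
    (x : R Φ) : p x :=
  Quot.ind (fun r => h r.obj r.mem r.endo) x

theorem mk_whiskerLeft {a X : K} (ha : a ∈ Φ.carrier) (hX : X ∈ Φ.carrier) (f : balancedEnd X)
    (h : a ◁ (f : End X) ∈ balancedEnd (a ⊗ X)) :
    mk (Φ.tensor_mem ha hX) ⟨a ◁ (f : End X), h⟩ = mk hX f :=
  (Quot.sound (RingRel.whiskerLeft ⟨X, hX, f⟩ a ha)).symm

theorem mk_whiskerRight {X a : K} (hX : X ∈ Φ.carrier) (ha : a ∈ Φ.carrier) (f : balancedEnd X)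
    (h : (f : End X) ▷ a ∈ balancedEnd (X ⊗ a)) :
    mk (Φ.tensor_mem hX ha) ⟨(f : End X) ▷ a, h⟩ = mk hX f :=
  (Quot.sound (RingRel.whiskerRight ⟨X, hX, f⟩ a ha)).symm

/-- Conjugate endomorphisms have the same class. -/
theorem mk_eq_of_iso {X Y : K} (hX : X ∈ Φ.carrier) (hY : Y ∈ Φ.carrier) (e : X ≅ Y)
    (f : X ⟶ X) (g : Y ⟶ Y) (hf : f ∈ balancedEnd X) (hg : g ∈ balancedEnd Y)
    (h : f ≫ e.hom = e.hom ≫ g) : mk hX ⟨f, hf⟩ = mk hY ⟨g, hg⟩ := by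
  have key : f ▷ Y = X ◁ g := by
    have hg' : g = e.inv ≫ f ≫ e.hom := by simp [h]
    rw [hg', MonoidalCategory.whiskerLeft_comp, MonoidalCategory.whiskerLeft_comp,
      ← (mem_balancedEnd f).1 hf, ← whisker_exchange, ← MonoidalCategory.whiskerLeft_comp_assoc]
    simp
  rw [← mk_whiskerRight hX hY ⟨f, hf⟩ (whiskerRight_mem _ hf Y),
    ← mk_whiskerLeft hX hY ⟨g, hg⟩ (whiskerLeft_mem X _ hg)]
  congr 2

/-- Representatives of the sum: `(X, f) + (Y, g) = (X ⊗ Y, f ⊗ Y + X ⊗ g)`. -/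
def addRep (r s : Rep Φ) : Rep Φ :=
  Rep.of (Φ.tensor_mem r.mem s.mem) (r.hom ▷ s.obj + r.obj ◁ s.hom)
    ((balancedEnd _).add_mem (whiskerRight_mem _ r.hom_mem _) (whiskerLeft_mem _ _ s.hom_mem))

/-- Representatives of the product: `(X, f) * (Y, g) = (X ⊗ Y, (f ⊗ Y) ∘ (X ⊗ g))`. -/
def mulRep (r s : Rep Φ) : Rep Φ :=
  Rep.of (Φ.tensor_mem r.mem s.mem) (r.obj ◁ s.hom ≫ r.hom ▷ s.obj)
    ((balancedEnd _).mul_mem (whiskerRight_mem _ r.hom_mem _) (whiskerLeft_mem _ _ s.hom_mem))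

/-- Addition on `R_Φ`: `[f_X] + [g_Y] = [f ⊗ Y + X ⊗ g]`. -/
def add (x y : R Φ) : R Φ := by
  refine Quot.lift₂ (fun r s => Quot.mk _ (addRep r s)) ?_ ?_ x y
  · rintro r s _ (⟨a, ha⟩ | ⟨a, ha⟩)
    · refine (Quot.sound (RingRel.whiskerLeft (addRep r s) a ha)).trans ?_
      refine (mk_eq_of_iso _ _ (swapLeft r.obj a s.obj) _ _ _ _ ?_).symm
      change (r.hom ▷ (a ⊗ s.obj) + r.obj ◁ (a ◁ s.hom)) ≫ _ =
        _ ≫ a ◁ (r.hom ▷ s.obj + r.obj ◁ s.hom)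
      rw [MonoidalPreadditive.whiskerLeft_add, Preadditive.add_comp, Preadditive.comp_add,
        swapLeft_left, swapLeft_right]
    · refine (Quot.sound (RingRel.whiskerRight (addRep r s) a ha)).trans ?_
      refine (mk_eq_of_iso _ _ (α_ r.obj s.obj a).symm _ _ _ _ ?_).symm
      change (r.hom ▷ (s.obj ⊗ a) + r.obj ◁ (s.hom ▷ a)) ≫ _ =
        _ ≫ (r.hom ▷ s.obj + r.obj ◁ s.hom) ▷ a
      rw [MonoidalPreadditive.add_whiskerRight, Preadditive.add_comp, Preadditive.comp_add]
      simp
  · rintro r _ s (⟨a, ha⟩ | ⟨a, ha⟩)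
    · refine (Quot.sound (RingRel.whiskerLeft (addRep r s) a ha)).trans ?_
      refine (mk_eq_of_iso _ _ (α_ a r.obj s.obj) _ _ _ _ ?_).symm
      change ((a ◁ r.hom) ▷ s.obj + (a ⊗ r.obj) ◁ s.hom) ≫ _ =
        _ ≫ a ◁ (r.hom ▷ s.obj + r.obj ◁ s.hom)
      rw [MonoidalPreadditive.whiskerLeft_add, Preadditive.add_comp, Preadditive.comp_add]
      simp
    · refine (Quot.sound (RingRel.whiskerRight (addRep r s) a ha)).trans ?_
      refine (mk_eq_of_iso _ _ (swapRight r.obj a s.obj) _ _ _ _ ?_).symm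
      change ((r.hom ▷ a) ▷ s.obj + (r.obj ⊗ a) ◁ s.hom) ≫ _ =
        _ ≫ (r.hom ▷ s.obj + r.obj ◁ s.hom) ▷ a
      rw [MonoidalPreadditive.add_whiskerRight, Preadditive.add_comp, Preadditive.comp_add,
        swapRight_left, swapRight_right]

/-- Multiplication on `R_Φ`: `[f_X] * [g_Y] = [(f ⊗ Y) ∘ (X ⊗ g)]`. -/
def mul (x y : R Φ) : R Φ := by
  refine Quot.lift₂ (fun r s => Quot.mk _ (mulRep r s)) ?_ ?_ x y
  · rintro r s _ (⟨a, ha⟩ | ⟨a, ha⟩)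
    · refine (Quot.sound (RingRel.whiskerLeft (mulRep r s) a ha)).trans ?_
      refine (mk_eq_of_iso _ _ (swapLeft r.obj a s.obj) _ _ _ _ ?_).symm
      change (r.obj ◁ (a ◁ s.hom) ≫ r.hom ▷ (a ⊗ s.obj)) ≫ _ =
        _ ≫ a ◁ (r.obj ◁ s.hom ≫ r.hom ▷ s.obj)
      rw [MonoidalCategory.whiskerLeft_comp, Category.assoc, swapLeft_left,
        reassoc_of% swapLeft_right]
    · refine (Quot.sound (RingRel.whiskerRight (mulRep r s) a ha)).trans ?_
      refine (mk_eq_of_iso _ _ (α_ r.obj s.obj a).symm _ _ _ _ ?_).symm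
      change (r.obj ◁ (s.hom ▷ a) ≫ r.hom ▷ (s.obj ⊗ a)) ≫ _ =
        _ ≫ (r.obj ◁ s.hom ≫ r.hom ▷ s.obj) ▷ a
      simp
  · rintro r _ s (⟨a, ha⟩ | ⟨a, ha⟩)
    · refine (Quot.sound (RingRel.whiskerLeft (mulRep r s) a ha)).trans ?_
      refine (mk_eq_of_iso _ _ (α_ a r.obj s.obj) _ _ _ _ ?_).symm
      change ((a ⊗ r.obj) ◁ s.hom ≫ (a ◁ r.hom) ▷ s.obj) ≫ _ =
        _ ≫ a ◁ (r.obj ◁ s.hom ≫ r.hom ▷ s.obj)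
      simp
    · refine (Quot.sound (RingRel.whiskerRight (mulRep r s) a ha)).trans ?_
      refine (mk_eq_of_iso _ _ (swapRight r.obj a s.obj) _ _ _ _ ?_).symm
      change ((r.obj ⊗ a) ◁ s.hom ≫ (r.hom ▷ a) ▷ s.obj) ≫ _ =
        _ ≫ (r.obj ◁ s.hom ≫ r.hom ▷ s.obj) ▷ a
      rw [comp_whiskerRight, Category.assoc, swapRight_left, reassoc_of% swapRight_right]

instance : Add (R Φ) := ⟨add⟩
instance : Mul (R Φ) := ⟨mul⟩
noncomputable instance : Zero (R Φ) := ⟨mk Φ.nonempty.choose_spec 0⟩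
noncomputable instance : One (R Φ) := ⟨mk Φ.nonempty.choose_spec 1⟩
instance : Neg (R Φ) :=
  ⟨Quot.lift (fun r => mk r.mem (-r.endo)) (by
    rintro r _ (⟨a, ha⟩ | ⟨a, ha⟩)
    · refine (Quot.sound (RingRel.whiskerLeft ⟨r.obj, r.mem, -r.endo⟩ a ha)).trans ?_
      exact congrArg (Quot.mk _) (congrArg (Rep.mk _ _)
        (Subtype.ext ((tensorLeft a).map_neg (f := r.hom))))
    · refine (Quot.sound (RingRel.whiskerRight ⟨r.obj, r.mem, -r.endo⟩ a ha)).trans ?_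
      exact congrArg (Quot.mk _) (congrArg (Rep.mk _ _)
        (Subtype.ext ((tensorRight a).map_neg (f := r.hom)))))⟩

theorem neg_mk {X : K} (hX : X ∈ Φ.carrier) (f : balancedEnd X) : -mk hX f = mk hX (-f) := rfl

theorem mk_add_mk {X : K} (hX : X ∈ Φ.carrier) (f g : balancedEnd X) :
    mk hX f + mk hX g = mk hX (f + g) := by
  rw [← mk_whiskerRight hX hX (f + g) (whiskerRight_mem _ (f + g).2 X)]
  refine congrArg (Quot.mk _) (congrArg (Rep.mk _ _) (Subtype.ext ?_))
  obtain ⟨(f : X ⟶ X), hf⟩ := f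
  obtain ⟨(g : X ⟶ X), hg⟩ := g
  change f ▷ X + X ◁ g = (f + g) ▷ X
  rw [← (mem_balancedEnd g).1 hg, ← MonoidalPreadditive.add_whiskerRight]

theorem mk_mul_mk {X : K} (hX : X ∈ Φ.carrier) (f g : balancedEnd X) :
    mk hX f * mk hX g = mk hX (f * g) := by
  rw [← mk_whiskerRight hX hX (f * g) (whiskerRight_mem _ (f * g).2 X)]
  refine congrArg (Quot.mk _) (congrArg (Rep.mk _ _) (Subtype.ext ?_))
  obtain ⟨(f : X ⟶ X), hf⟩ := f
  obtain ⟨(g : X ⟶ X), hg⟩ := g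
  change X ◁ g ≫ f ▷ X = (g ≫ f) ▷ X
  rw [← (mem_balancedEnd g).1 hg, comp_whiskerRight]

theorem mk_zero {X : K} (hX : X ∈ Φ.carrier) : mk hX 0 = 0 := by
  refine mk_whiskerRight hX Φ.nonempty.choose_spec 0 (whiskerRight_mem _ (zero_mem _) _)
    |>.symm.trans ?_
  refine Eq.trans ?_
    (mk_whiskerLeft hX Φ.nonempty.choose_spec 0 (whiskerLeft_mem _ _ (zero_mem _)))
  refine congrArg (Quot.mk _) (congrArg (Rep.mk _ _) (Subtype.ext ?_))
  change (0 : X ⟶ X) ▷ _ = X ◁ (0 : _ ⟶ _)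
  simp

theorem mk_one {X : K} (hX : X ∈ Φ.carrier) : mk hX 1 = 1 := by
  refine mk_whiskerRight hX Φ.nonempty.choose_spec 1 (whiskerRight_mem _ (one_mem _) _)
    |>.symm.trans ?_
  refine Eq.trans ?_
    (mk_whiskerLeft hX Φ.nonempty.choose_spec 1 (whiskerLeft_mem _ _ (one_mem _)))
  refine congrArg (Quot.mk _) (congrArg (Rep.mk _ _) (Subtype.ext ?_))
  change (𝟙 X) ▷ _ = X ◁ (𝟙 _)
  simp

theorem exists_common₂ (x y : R Φ) : ∃ (X : K) (hX : X ∈ Φ.carrier) (f g : balancedEnd X),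
    x = mk hX f ∧ y = mk hX g ∧ f * g = g * f := by
  induction x using ind with | h X hX f =>
  induction y using ind with | h Y hY g =>
  refine ⟨X ⊗ Y, Φ.tensor_mem hX hY, ⟨_, whiskerRight_mem _ f.2 Y⟩, ⟨_, whiskerLeft_mem X _ g.2⟩,
    (mk_whiskerRight hX hY f _).symm, (mk_whiskerLeft hX hY g _).symm, Subtype.ext ?_⟩
  exact whisker_exchange _ _

theorem exists_common₃ (x y z : R Φ) : ∃ (X : K) (hX : X ∈ Φ.carrier) (f g h : balancedEnd X),
    x = mk hX f ∧ y = mk hX g ∧ z = mk hX h := by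
  obtain ⟨X, hX, f, g, rfl, rfl, -⟩ := exists_common₂ x y
  induction z using ind with | h Z hZ h =>
  exact ⟨X ⊗ Z, Φ.tensor_mem hX hZ, ⟨_, whiskerRight_mem _ f.2 Z⟩, ⟨_, whiskerRight_mem _ g.2 Z⟩,
    ⟨_, whiskerLeft_mem X _ h.2⟩, (mk_whiskerRight hX hZ f _).symm,
    (mk_whiskerRight hX hZ g _).symm, (mk_whiskerLeft hX hZ h _).symm⟩

noncomputable instance : CommRing (R Φ) where
  add_assoc x y z := by
    obtain ⟨X, hX, f, g, h, rfl, rfl, rfl⟩ := exists_common₃ x y z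
    simp only [mk_add_mk, add_assoc]
  zero_add x := by
    induction x using ind with | h X hX f =>
    rw [← mk_zero hX, mk_add_mk, zero_add]
  add_zero x := by
    induction x using ind with | h X hX f =>
    rw [← mk_zero hX, mk_add_mk, add_zero]
  add_comm x y := by
    obtain ⟨X, hX, f, g, rfl, rfl, -⟩ := exists_common₂ x y
    simp only [mk_add_mk, add_comm]
  neg_add_cancel x := by
    induction x using ind with | h X hX f =>
    rw [neg_mk, mk_add_mk, neg_add_cancel, mk_zero]
  mul_assoc x y z := by
    obtain ⟨X, hX, f, g, h, rfl, rfl, rfl⟩ := exists_common₃ x y z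
    simp only [mk_mul_mk, mul_assoc]
  one_mul x := by
    induction x using ind with | h X hX f =>
    rw [← mk_one hX, mk_mul_mk, one_mul]
  mul_one x := by
    induction x using ind with | h X hX f =>
    rw [← mk_one hX, mk_mul_mk, mul_one]
  left_distrib x y z := by
    obtain ⟨X, hX, f, g, h, rfl, rfl, rfl⟩ := exists_common₃ x y z
    simp only [mk_add_mk, mk_mul_mk, mul_add]
  right_distrib x y z := by
    obtain ⟨X, hX, f, g, h, rfl, rfl, rfl⟩ := exists_common₃ x y z
    simp only [mk_add_mk, mk_mul_mk, add_mul]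
  zero_mul x := by
    induction x using ind with | h X hX f =>
    rw [← mk_zero hX, mk_mul_mk, zero_mul]
  mul_zero x := by
    induction x using ind with | h X hX f =>
    rw [← mk_zero hX, mk_mul_mk, mul_zero]
  mul_comm x y := by
    obtain ⟨X, hX, f, g, rfl, rfl, hfg⟩ := exists_common₂ x y
    rw [mk_mul_mk, mk_mul_mk, hfg]
  nsmul := nsmulRec
  zsmul := zsmulRec

end R

end Ring

end TensorTriangular

namespace TensorTriangular

/-! ### An ultrafilter criterion for spectral spaces -/

section Spectral

open TopologicalSpace Set

variable {X Y : Type*} {ι κ : Type*}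

/-! Spectrality is tested with ultrafilters. A T0 space is spectral as soon as every ultrafilter has
a limit in the topology that makes the members of a chosen basis clopen
(`spectralSpace_of_isPatchLimit`). For `Spc K` with the basis `(supp a)ᶜ`, the limit is the set of
objects lying in almost every prime: each axiom of a prime ideal is finitary, so it survives an
ultrafilter (`Spc.limit`). The limit of primes in `Z_Φ` is again in `Z_Φ`. Maps are then spectral
because preimages of basic opens are basic opens.

The comparison map rests on `whiskerRight_cone_comp_self`: for balanced `f`, the endomorphism `f ⊗
cone f` squares to zero. Membership of a cone in `P` is expressed by `P.trW`, which is independent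
of the chosen cone and stable under composition. If a nilpotent endomorphism of an object has its
cone in `P`, then the object is in `P`. Suppose `f` and `g` commute and `fg` has its cone in `P`.
Tensoring with `cone f` makes `fg` nilpotent, so `X ⊗ cone f` lies in `P`, and `cone f` does too
since `X ∉ P`. For `f + g`, tensoring with both cones gives a sum of commuting nilpotents, hence
`cone f ∈ P` or `cone g ∈ P`. So the classes with cone outside `P` form an ideal; it is prime
because `P.trW` is stable under composition.

The square commutes because an exact functor carries a cone of `f` to a cone of `F f`. -/

/-- `x` is a limit of the ultrafilter `F` in the topology in which all `U i` are clopen. -/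
def IsPatchLimit (U : ι → Set X) (F : Ultrafilter X) (x : X) : Prop :=
  ∀ i, x ∈ U i ↔ U i ∈ F

variable [TopologicalSpace X] [TopologicalSpace Y] {U : ι → Set X}

/-- A patch limit is in particular a limit in the original topology, so any set stable under patch
limits is compact. -/
theorem isCompact_of_isPatchLimit (hU : IsTopologicalBasis (range U))
    (hlim : ∀ F : Ultrafilter X, ∃ x, IsPatchLimit U F x) {s : Set X}
    (hs : ∀ (F : Ultrafilter X) (x : X), IsPatchLimit U F x → s ∈ F → x ∈ s) : IsCompact s := by
  rw [isCompact_iff_ultrafilter_le_nhds']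
  intro F hF
  obtain ⟨x, hx⟩ := hlim F
  refine ⟨x, hs F x hx hF, fun t ht => ?_⟩
  obtain ⟨_, ⟨i, rfl⟩, hxi, hit⟩ := hU.mem_nhds_iff.1 ht
  exact Filter.mem_of_superset ((hx i).1 hxi) hit

theorem isCompact_basis_of_isPatchLimit (hU : IsTopologicalBasis (range U))
    (hlim : ∀ F : Ultrafilter X, ∃ x, IsPatchLimit U F x) (i : ι) : IsCompact (U i) :=
  isCompact_of_isPatchLimit hU hlim fun _ _ hx h => (hx i).2 h

/-- A compact open set is a finite union of basic sets, and an ultrafilter containing a finite union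
contains one of its members. Compact opens are thus stable under patch limits, and so are their
pairwise intersections. -/
theorem mem_of_isPatchLimit (hU : IsTopologicalBasis (range U))
    (hlim : ∀ F : Ultrafilter X, ∃ x, IsPatchLimit U F x) {s : Set X} (ho : IsOpen s)
    (hc : IsCompact s) {F : Ultrafilter X} {x : X} (hx : IsPatchLimit U F x) (h : s ∈ F) :
    x ∈ s := by
  obtain ⟨t, ht, rfl⟩ := (isCompact_open_iff_eq_finite_iUnion_of_isTopologicalBasis U hU
    (isCompact_basis_of_isPatchLimit hU hlim) s).1 ⟨hc, ho⟩
  obtain ⟨i, hi, hiF⟩ := (Ultrafilter.finite_biUnion_mem_iff ht).1 h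
  exact mem_biUnion hi ((hx i).2 hiF)

theorem exists_isGenericPoint_of_isPatchLimit (hU : IsTopologicalBasis (range U))
    (hlim : ∀ F : Ultrafilter X, ∃ x, IsPatchLimit U F x) {Z : Set X} (hZ : IsIrreducible Z)
    (hZc : IsClosed Z) : ∃ x, IsGenericPoint x Z := by
  -- The filter generated by the non-empty traces on `Z` of open sets; irreducibility is what closes
  -- it under intersection. A patch limit of a finer ultrafilter lies in every basic open meeting
  -- `Z`, so it is generic once it is known to lie in `Z`.
  let G : Filter X :=
    { sets := {s | ∃ V, IsOpen V ∧ (Z ∩ V).Nonempty ∧ Z ∩ V ⊆ s}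
      univ_sets := ⟨univ, isOpen_univ, by simpa using hZ.1, subset_univ _⟩
      sets_of_superset := fun ⟨V, hV, hne, h⟩ hst => ⟨V, hV, hne, h.trans hst⟩
      inter_sets := fun ⟨V, hV, hne, h⟩ ⟨W, hW, hne', h'⟩ =>
        ⟨V ∩ W, hV.inter hW, hZ.2 V W hV hW hne hne', fun x hx =>
          ⟨h ⟨hx.1, hx.2.1⟩, h' ⟨hx.1, hx.2.2⟩⟩⟩ }
  have hG : G.NeBot := ⟨fun h => by
    obtain ⟨V, -, hne, hV⟩ := (Filter.empty_mem_iff_bot.2 h : (∅ : Set X) ∈ G)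
    exact (hne.mono hV).ne_empty rfl⟩
  have hle : ((Ultrafilter.of G : Ultrafilter X) : Filter X) ≤ G := Ultrafilter.of_le G
  have hZF : Z ∈ Ultrafilter.of G :=
    hle ⟨univ, isOpen_univ, by simpa using hZ.1, inter_subset_left⟩
  obtain ⟨x, hx⟩ := hlim (Ultrafilter.of G)
  refine ⟨x, Subset.antisymm (hZc.closure_subset_iff.2 (singleton_subset_iff.2 ?_)) ?_⟩
  · by_contra hxZ
    obtain ⟨_, ⟨i, rfl⟩, hxi, hi⟩ := hU.exists_subset_of_mem_open hxZ hZc.isOpen_compl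
    have := Filter.inter_mem ((hx i).1 hxi) hZF
    rw [(disjoint_compl_left.mono_left hi).inter_eq] at this
    exact Ultrafilter.empty_notMem this
  · intro z hz
    rw [hU.mem_closure_iff]
    rintro _ ⟨i, rfl⟩ hzi
    have hi : U i ∈ Ultrafilter.of G :=
      hle ⟨U i, hU.isOpen ⟨i, rfl⟩, ⟨z, hz, hzi⟩, inter_subset_right⟩
    exact ⟨x, (hx i).2 hi, rfl⟩

/-- A T0 space with a basis `U` is spectral if every ultrafilter has a limit for the topology in
which the members of the basis are clopen. -/
theorem spectralSpace_of_isPatchLimit [T0Space X] (hU : IsTopologicalBasis (range U))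
    (hlim : ∀ F : Ultrafilter X, ∃ x, IsPatchLimit U F x) : SpectralSpace X where
  isCompact_univ := isCompact_of_isPatchLimit hU hlim fun _ _ _ _ => mem_univ _
  sober := exists_isGenericPoint_of_isPatchLimit hU hlim
  inter_isCompact _ _ hs hs' ht ht' := isCompact_of_isPatchLimit hU hlim fun _ _ hx h =>
    ⟨mem_of_isPatchLimit hU hlim hs hs' hx (Filter.mem_of_superset h inter_subset_left),
      mem_of_isPatchLimit hU hlim ht ht' hx (Filter.mem_of_superset h inter_subset_right)⟩
  isTopologicalBasis := (PrespectralSpace.of_isTopologicalBasis' hU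
    (isCompact_basis_of_isPatchLimit hU hlim)).isTopologicalBasis

theorem isSpectralMap_of_basis {V : κ → Set Y} (hV : IsTopologicalBasis (range V))
    (hVc : ∀ j, IsCompact (V j)) {f : X → Y} (hfo : ∀ j, IsOpen (f ⁻¹' V j))
    (hfc : ∀ j, IsCompact (f ⁻¹' V j)) : IsSpectralMap f where
  toContinuous := hV.continuous_iff.2 (by rintro _ ⟨j, rfl⟩; exact hfo j)
  isCompact_preimage_of_isOpen s ho hc := by
    obtain ⟨t, ht, rfl⟩ :=
      (isCompact_open_iff_eq_finite_iUnion_of_isTopologicalBasis V hV hVc s).1 ⟨hc, ho⟩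
    rw [preimage_iUnion₂]
    exact ht.isCompact_biUnion fun j _ => hfc j

end Spectral

/-! ### The spectrum is a spectral space -/

section Spectrum

open TopologicalSpace ZeroObject

theorem prop_tensorUnit_iff_eq_top {K : Type u} [Category.{v} K] [MonoidalCategory K]
    {P : ObjectProperty K} [P.IsClosedUnderIsomorphisms]
    (hP : ∀ a b : K, P b → P (a ⊗ b)) : P (𝟙_ K) ↔ P = ⊤ :=
  ⟨fun h => top_unique fun a _ => P.prop_of_iso (ρ_ a) (hP a _ h), fun h => h ▸ trivial⟩

variable {K : Type u} [Category.{v} K] [Preadditive K] [HasZeroObject K] [HasShift K ℤ]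
  [∀ n : ℤ, (shiftFunctor K n).Additive] [Pretriangulated K] [MonoidalCategory K]

instance (P : Spc K) : P.asIdeal.IsTriangulated := P.isPrime.isTriangulated

instance (P : Spc K) : P.asIdeal.IsStableUnderRetracts := P.isPrime.isStableUnderRetracts

theorem mem_supp_compl {P : Spc K} {a : K} : P ∈ (supp a)ᶜ ↔ P.asIdeal a := not_not

instance : T0Space (Spc K) where
  t0 P Q h := Spc.ext <| funext fun a => propext <| by
    have := h.mem_open_iff (s := (supp a)ᶜ) (isOpen_generateFrom_of_mem ⟨a, rfl⟩)
    rwa [mem_supp_compl, mem_supp_compl] at this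

theorem prop_biprod_iff (P : Spc K) (a b : K) :
    P.asIdeal (a ⊞ b) ↔ P.asIdeal a ∧ P.asIdeal b :=
  ⟨fun h => ⟨ObjectProperty.IsStableUnderRetracts.of_biprod_left _ h,
    ObjectProperty.IsStableUnderRetracts.of_biprod_right _ h⟩, fun h =>
    P.asIdeal.ext_of_isTriangulatedClosed₂ _ (binaryBiproductTriangle_distinguished a b) h.1 h.2⟩

theorem isTopologicalBasis_supp_compl :
    IsTopologicalBasis (Set.range fun a : K => (supp a)ᶜ) := by
  have h := isTopologicalBasis_of_subbasis_of_inter (r := Set.range fun a : K => (supp a)ᶜ) rfl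
    (by
      rintro _ ⟨a, rfl⟩ _ ⟨b, rfl⟩
      -- A thick subcategory contains a direct sum exactly when it contains both summands, so the
      -- sets `(supp a)ᶜ` are closed under intersection.
      exact ⟨a ⊞ b, Set.ext fun P => by
        simp only [mem_supp_compl, prop_biprod_iff, Set.mem_inter_iff]⟩)
  rwa [Set.insert_eq_of_mem] at h
  exact ⟨0, Set.eq_univ_of_forall fun P => mem_supp_compl.2 (P.asIdeal.prop_of_isZero (isZero_zero K))⟩

theorem Spc.not_prop_tensorUnit (P : Spc K) : ¬ P.asIdeal (𝟙_ K) := fun h =>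
  P.isPrime.ne_top ((prop_tensorUnit_iff_eq_top P.isPrime.tensor_mem).1 h)

/-- The prime ideal of all objects that lie in almost every member of an ultrafilter. -/
def Spc.limit (F : Ultrafilter (Spc K)) : Spc K where
  asIdeal a := (supp a)ᶜ ∈ F
  isPrime := by
    have hr : ObjectProperty.IsStableUnderRetracts fun a : K => (supp a)ᶜ ∈ F :=
      ⟨fun {X Y} r h => Filter.mem_of_superset h fun P hP =>
        mem_supp_compl.2 (P.asIdeal.prop_of_retract r (mem_supp_compl.1 hP))⟩
    have ht (a b : K) (h : (supp b)ᶜ ∈ F) : (supp (a ⊗ b))ᶜ ∈ F :=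
      Filter.mem_of_superset h fun P hP =>
        mem_supp_compl.2 (P.isPrime.tensor_mem a b (mem_supp_compl.1 hP))
    refine ⟨?_, hr, ht, fun h => ?_, fun a b h => ?_⟩
    · exact
        { exists_zero := ⟨0, isZero_zero K, Filter.mem_of_superset Filter.univ_mem fun P _ =>
            mem_supp_compl.2 (P.asIdeal.prop_of_isZero (isZero_zero K))⟩
          isStableUnderShiftBy := fun n => ⟨fun a h => Filter.mem_of_superset h fun P hP =>
            mem_supp_compl.2 (P.asIdeal.le_shift n a (mem_supp_compl.1 hP))⟩
          toIsTriangulatedClosed₂ := .mk' fun T hT h₁ h₃ =>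
            Filter.mem_of_superset (Filter.inter_mem h₁ h₃) fun P hP =>
              mem_supp_compl.2 (P.asIdeal.ext_of_isTriangulatedClosed₂ T hT
                (mem_supp_compl.1 hP.1) (mem_supp_compl.1 hP.2)) }
    · have h1 := (prop_tensorUnit_iff_eq_top ht).2 h
      refine Ultrafilter.empty_notMem (f := F) (Filter.mem_of_superset h1 fun P hP => ?_)
      exact P.not_prop_tensorUnit (mem_supp_compl.1 hP)
    -- The only axiom that needs an ultrafilter: a disjunction holding almost everywhere has one
    -- alternative holding almost everywhere.
    · refine Ultrafilter.union_mem_iff.1 (Filter.mem_of_superset h fun P hP => ?_)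
      exact (P.isPrime.mem_or_mem a b (mem_supp_compl.1 hP)).imp mem_supp_compl.2 mem_supp_compl.2

theorem Spc.isPatchLimit_limit (F : Ultrafilter (Spc K)) :
    IsPatchLimit (fun a : K => (supp a)ᶜ) F (Spc.limit F) := fun _ =>
  mem_supp_compl

instance : SpectralSpace (Spc K) :=
  spectralSpace_of_isPatchLimit isTopologicalBasis_supp_compl
    fun F => ⟨_, Spc.isPatchLimit_limit F⟩

theorem isOpen_supp_compl (a : K) : IsOpen (supp a)ᶜ :=
  isTopologicalBasis_supp_compl.isOpen ⟨a, rfl⟩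

theorem isCompact_supp_compl (a : K) : IsCompact (supp a)ᶜ :=
  isCompact_basis_of_isPatchLimit isTopologicalBasis_supp_compl
    (fun F => ⟨_, Spc.isPatchLimit_limit F⟩) a

/-! ### The subspace `Z_Φ` is spectral and spectrally embedded. -/

namespace TensorMultiplicativeSet

variable (Φ : TensorMultiplicativeSet K)

theorem isTopologicalBasis_supp_compl :
    IsTopologicalBasis (Set.range fun a : K => (Subtype.val ⁻¹' (supp a)ᶜ : Set Φ.zeroLocus)) := by
  have h := TensorTriangular.isTopologicalBasis_supp_compl.isInducing
    (Topology.IsInducing.subtypeVal (t := Φ.zeroLocus))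
  rwa [← Set.range_comp] at h

/-- `Z_Φ` is stable under patch limits: if the limit contained some `X ∈ Φ`, so would almost every
prime of `Z_Φ`, yet none does. -/
theorem exists_isPatchLimit (F : Ultrafilter Φ.zeroLocus) :
    ∃ P, IsPatchLimit (fun a : K => (Subtype.val ⁻¹' (supp a)ᶜ : Set Φ.zeroLocus)) F P := by
  have hP := Spc.isPatchLimit_limit (F.map Subtype.val)
  refine ⟨⟨Spc.limit (F.map Subtype.val), Set.mem_iInter₂.2 fun X hX => ?_⟩, hP⟩
  by_contra h
  have := (hP X).1 h
  refine Ultrafilter.empty_notMem (f := F) (Filter.mem_of_superset this fun P hPX => ?_)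
  exact hPX (Set.mem_iInter₂.1 P.2 X hX)

instance : SpectralSpace Φ.zeroLocus :=
  spectralSpace_of_isPatchLimit Φ.isTopologicalBasis_supp_compl Φ.exists_isPatchLimit

theorem isOpen_supp_compl (a : K) : IsOpen (Subtype.val ⁻¹' (supp a)ᶜ : Set Φ.zeroLocus) :=
  Φ.isTopologicalBasis_supp_compl.isOpen ⟨a, rfl⟩

theorem isCompact_supp_compl (a : K) : IsCompact (Subtype.val ⁻¹' (supp a)ᶜ : Set Φ.zeroLocus) :=
  isCompact_basis_of_isPatchLimit Φ.isTopologicalBasis_supp_compl Φ.exists_isPatchLimit a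

theorem isSpectralMap_val : IsSpectralMap (Subtype.val : Φ.zeroLocus → Spc K) :=
  isSpectralMap_of_basis TensorTriangular.isTopologicalBasis_supp_compl
    TensorTriangular.isCompact_supp_compl Φ.isOpen_supp_compl Φ.isCompact_supp_compl

end TensorMultiplicativeSet

end Spectrum

/-! ### Cones and prime ideals -/

theorem isNilpotent_of_iso {K : Type u} [Category.{v} K] [Preadditive K] {X Y : K} (e : X ≅ Y)
    (f : X ⟶ X) (g : Y ⟶ Y)
    (h : f ≫ e.hom = e.hom ≫ g) (hf : IsNilpotent (R := End X) f) : IsNilpotent (R := End Y) g := by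
  have : g = e.conj f := by rw [Iso.conj_apply, h, Iso.inv_hom_id_assoc]
  rw [this]
  obtain ⟨n, hn⟩ := hf
  refine ⟨n, ?_⟩
  rw [← Iso.conj_pow, hn]
  change e.inv ≫ 0 ≫ e.hom = 0
  simp

section Cone

variable {K : Type u} [Category.{v} K] [Preadditive K] [HasZeroObject K] [HasShift K ℤ]
  [∀ n : ℤ, (shiftFunctor K n).Additive] [Pretriangulated K]

theorem exists_distinguished_cone {X Y : K} (f : X ⟶ Y) :
    ∃ (g : Y ⟶ cone f) (h : cone f ⟶ X⟦(1 : ℤ)⟧), Triangle.mk f g h ∈ distTriang K :=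
  (distinguished_cocone_triangle f).choose_spec

/-- Frees the cone condition from the chosen cone: `trW` allows any distinguished triangle on `f`.
-/
theorem trW_iff_prop_cone (P : ObjectProperty K) [P.IsClosedUnderIsomorphisms] {X Y : K}
    (f : X ⟶ Y) : P.trW f ↔ P (cone f) := by
  obtain ⟨g, h, hT⟩ := exists_distinguished_cone f
  exact P.trW_iff_of_distinguished _ hT

/-- In a triangle on the zero map of `X`, the identity of `X` factors through the cone, so `X` is a
retract of it. -/
theorem prop_of_trW_zero (P : ObjectProperty K) [P.IsStableUnderRetracts] {X : K}
    (h : P.trW (0 : X ⟶ X)) : P X := by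
  obtain ⟨Z, g, h, hT, hZ⟩ := h
  obtain ⟨r, hr⟩ := Triangle.yoneda_exact₂ _ hT (𝟙 X) zero_comp
  exact P.prop_of_retract ⟨g, r, hr.symm⟩ hZ

/-- Maps with cone in `P` compose, by the octahedral axiom, so some power of `f` is a zero map with
cone in `P`. -/
theorem prop_of_trW_of_isNilpotent [IsTriangulated K] (P : ObjectProperty K) [P.IsTriangulated]
    [P.IsStableUnderRetracts] {X : K} (f : End X) (hf : IsNilpotent f)
    (h : P.trW (show X ⟶ X from f)) : P X := by
  obtain ⟨n, hn⟩ := hf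
  refine prop_of_trW_zero P ?_
  have key : ∀ n : ℕ, P.trW (show X ⟶ X from f ^ n) := fun n => by
    induction n with
    | zero => exact P.trW.id_mem X
    | succ n ih =>
      rw [pow_succ, End.mul_def]
      exact P.trW.comp_mem _ _ h ih
  exact hn ▸ key n

variable [MonoidalCategory K]

theorem TensorMultiplicativeSet.not_prop_of_mem {Φ : TensorMultiplicativeSet K} (P : Φ.zeroLocus) {X : K} (hX : X ∈ Φ.carrier) :
    ¬ P.1.asIdeal X :=
  Set.mem_iInter₂.1 P.2 X hX

theorem Spc.prop_tensor_iff [SymmetricCategory K] (P : Spc K) (a b : K) :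
    P.asIdeal (a ⊗ b) ↔ P.asIdeal a ∨ P.asIdeal b :=
  ⟨P.isPrime.mem_or_mem a b, fun h => h.elim
    (fun h => P.asIdeal.prop_of_iso (β_ b a) (P.isPrime.tensor_mem b a h))
    (P.isPrime.tensor_mem a b)⟩

end Cone

/-! ### Balanced endomorphisms act nilpotently on their cones -/

section TT

variable {K : Type u} [Category.{v} K] [Preadditive K] [HasZeroObject K] [HasShift K ℤ]
  [∀ n : ℤ, (shiftFunctor K n).Additive] [Pretriangulated K]
  [MonoidalCategory K] [SymmetricCategory K] [TensorTriangulatedCategory K]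

/-- Tensoring is exact, so `a ⊗ cone f` is a cone of `a ◁ f`; primality does the rest. -/
theorem Spc.trW_whiskerLeft_iff (P : Spc K) (a : K) {X Y : K} (f : X ⟶ Y) :
    P.asIdeal.trW (a ◁ f) ↔ P.asIdeal a ∨ P.asIdeal.trW f := by
  obtain ⟨g, h, hT⟩ := exists_distinguished_cone f
  rw [trW_iff_prop_cone _ f, ← P.prop_tensor_iff]
  exact P.asIdeal.trW_iff_of_distinguished _ ((tensorLeft a).map_distinguished _ hT)

theorem Spc.trW_whiskerRight_iff (P : Spc K) {X Y : K} (f : X ⟶ Y) (a : K) :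
    P.asIdeal.trW (f ▷ a) ↔ P.asIdeal.trW f ∨ P.asIdeal a := by
  obtain ⟨g, h, hT⟩ := exists_distinguished_cone f
  rw [trW_iff_prop_cone _ f, ← P.prop_tensor_iff]
  exact P.asIdeal.trW_iff_of_distinguished _ ((tensorRight a).map_distinguished _ hT)

/-- The suspension isomorphism of `X ⊗ -` is natural in `X` as well, which is part of the
bifunctor's shift structure. -/
theorem whiskerRight_shift {X : K} (f : X ⟶ X) (Y : K) :
    f ▷ (Y⟦(1 : ℤ)⟧) ≫ ((tensorLeft X).commShiftIso (1 : ℤ)).hom.app Y =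
      ((tensorLeft X).commShiftIso (1 : ℤ)).hom.app Y ≫ (f ▷ Y)⟦(1 : ℤ)⟧' :=
  (NatTrans.shift_app_comm ((curriedTensor K).map f) (1 : ℤ) Y).symm

/-- A balanced endomorphism `f` squares to zero on its own cone. -/
theorem whiskerRight_cone_comp_self {X : K} (f : X ⟶ X) (hf : f ∈ balancedEnd X) :
    f ▷ cone f ≫ f ▷ cone f = 0 := by
  obtain ⟨u, w, hT⟩ := exists_distinguished_cone f
  have hT' := (tensorLeft X).map_distinguished _ hT
  -- Balancedness turns `f ▷ X` into `X ◁ f`, which is killed by `X ◁ u`. Hence `f ▷ cone f` factors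
  -- through the connecting map of the triangle tensored with `X`.
  have h₁ : X ◁ u ≫ f ▷ cone f = 0 := by
    have h0 : f ≫ u = 0 := comp_distTriang_mor_zero₁₂ _ hT
    rw [whisker_exchange, (mem_balancedEnd f).1 hf, ← MonoidalCategory.whiskerLeft_comp, h0,
      MonoidalPreadditive.whiskerLeft_zero]
  obtain ⟨t, ht⟩ := Triangle.yoneda_exact₃ _ hT' (f ▷ cone f) h₁
  -- The dual vanishing, using balancedness after a suspension: composing `f ▷ cone f` with the
  -- connecting map gives zero.
  have h₂ : f ▷ cone f ≫ X ◁ w ≫ ((tensorLeft X).commShiftIso (1 : ℤ)).hom.app X = 0 := by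
    have h0 : w ≫ f⟦(1 : ℤ)⟧' = 0 := comp_distTriang_mor_zero₃₁ _ hT
    have h3 := ((tensorLeft X).commShiftIso (1 : ℤ)).hom.naturality f
    rw [← whisker_exchange_assoc, whiskerRight_shift, (mem_balancedEnd f).1 hf]
    refine (congrArg (X ◁ w ≫ ·) h3.symm).trans ?_
    change X ◁ w ≫ X ◁ f⟦(1 : ℤ)⟧' ≫ _ = 0
    rw [← MonoidalCategory.whiskerLeft_comp_assoc, h0, MonoidalPreadditive.whiskerLeft_zero,
      zero_comp]
  nth_rw 2 [ht]
  exact (Category.assoc _ _ _).symm.trans ((congrArg (· ≫ t) h₂).trans zero_comp)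

theorem isNilpotent_whiskerRight_cone {X : K} (f : X ⟶ X) (hf : f ∈ balancedEnd X) :
    IsNilpotent (R := End (X ⊗ cone f)) (f ▷ cone f) :=
  ⟨2, by rw [pow_two]; exact whiskerRight_cone_comp_self f hf⟩

/-- Tensoring with a fixed object on the right, on endomorphism rings. -/
def whiskerRightEnd (X a : K) : End X →+* End (X ⊗ a) where
  toFun f := f ▷ a
  map_one' := id_whiskerRight X a
  map_mul' f g := comp_whiskerRight g f a
  map_zero' := MonoidalPreadditive.zero_whiskerRight
  map_add' f g := MonoidalPreadditive.add_whiskerRight f g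

/-- On `X ⊗ cone f` the product is nilpotent, because `f` is and `g` commutes with it. So `X ⊗ cone
f ∈ P`, and `X ∉ P`. -/
theorem Spc.trW_left_of_trW_mul (P : Spc K) {X : K} (hX : ¬ P.asIdeal X) (f g : X ⟶ X)
    (hf : f ∈ balancedEnd X) (hfg : Commute (S := End X) f g) (h : P.asIdeal.trW (f ≫ g)) :
    P.asIdeal.trW f := by
  rw [trW_iff_prop_cone]
  refine ((P.prop_tensor_iff X _).1 ?_).resolve_left hX
  refine prop_of_trW_of_isNilpotent _ (whiskerRightEnd X (cone f) (HMul.hMul (α := End X) (β := End X) g f)) ?_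
    ((P.trW_whiskerRight_iff (f ≫ g) _).2 (.inl h))
  rw [map_mul]
  exact ((hfg.symm.map (whiskerRightEnd X (cone f))).isNilpotent_mul_left
    (isNilpotent_whiskerRight_cone f hf))

/-- After tensoring with both cones, `f` and `g` become commuting nilpotents, so their sum is
nilpotent and primality applies to `(X ⊗ cone f) ⊗ cone g`. -/
theorem Spc.trW_or_trW_of_trW_add (P : Spc K) {X : K} (hX : ¬ P.asIdeal X) (f g : X ⟶ X)
    (hf : f ∈ balancedEnd X) (hg : g ∈ balancedEnd X) (hfg : Commute (S := End X) f g)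
    (h : P.asIdeal.trW (f + g)) : P.asIdeal.trW f ∨ P.asIdeal.trW g := by
  rw [trW_iff_prop_cone _ f, trW_iff_prop_cone _ g]
  have key : P.asIdeal ((X ⊗ cone f) ⊗ cone g) := by
    let φ := (whiskerRightEnd (X ⊗ cone f) (cone g)).comp (whiskerRightEnd X (cone f))
    refine prop_of_trW_of_isNilpotent _ (φ (f + g : End X)) ?_
      ((P.trW_whiskerRight_iff _ _).2 (.inl ((P.trW_whiskerRight_iff _ _).2 (.inl h))))
    rw [map_add]
    refine (hfg.map φ).isNilpotent_add ?_ ?_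
    · exact (isNilpotent_whiskerRight_cone f hf).map (whiskerRightEnd (X ⊗ cone f) (cone g))
    -- Here `g` meets `cone f` before `cone g`; the symmetry exchanges the two factors.
    · exact isNilpotent_of_iso _ _ _ (swapRight_left g (cone g) (cone f))
        ((isNilpotent_whiskerRight_cone g hg).map (whiskerRightEnd (X ⊗ cone g) (cone f)))
  rw [P.prop_tensor_iff, P.prop_tensor_iff] at key
  tauto

variable {Φ : TensorMultiplicativeSet K}

/-! ### The comparison map -/

/-- The condition that the cone of a representative lies outside `P`. -/
def R.NotTrW (P : Φ.zeroLocus) (x : R Φ) : Prop :=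
  Quot.lift (fun r : Rep Φ => ¬ P.1.asIdeal.trW r.hom) (by
    -- Independence of the representative uses `P ∈ Z_Φ`: no `a ∈ Φ` lies in `P`, so tensoring with
    -- `a` does not affect whether the cone does.
    rintro r _ (⟨a, ha⟩ | ⟨a, ha⟩) <;> refine propext (not_congr ?_)
    · exact ((P.1.trW_whiskerLeft_iff a r.hom).trans
        (or_iff_right (TensorMultiplicativeSet.not_prop_of_mem P ha))).symm
    · exact ((P.1.trW_whiskerRight_iff r.hom a).trans
        (or_iff_left (TensorMultiplicativeSet.not_prop_of_mem P ha))).symm) x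

theorem R.notTrW_mk (P : Φ.zeroLocus) {X : K} (hX : X ∈ Φ.carrier) (f : balancedEnd X) :
    R.NotTrW P (R.mk hX f) ↔ ¬ P.1.asIdeal.trW (show X ⟶ X from (f : End X)) := Iff.rfl

/-- The comparison map `P ↦ {[f] | cone f ∉ P}`. -/
def comparison (P : Φ.zeroLocus) : PrimeSpectrum (R Φ) where
  asIdeal :=
    { carrier := {x | R.NotTrW P x}
      zero_mem' := by
        obtain ⟨X, hX⟩ := Φ.nonempty
        rw [← R.mk_zero hX]
        exact fun h => TensorMultiplicativeSet.not_prop_of_mem P hX (prop_of_trW_zero _ h)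
      add_mem' := fun {x y} hx hy => by
        obtain ⟨X, hX, f, g, rfl, rfl, hfg⟩ := R.exists_common₂ x y
        rw [R.mk_add_mk]
        exact fun h => (P.1.trW_or_trW_of_trW_add
          (TensorMultiplicativeSet.not_prop_of_mem P hX) _ _ f.2 g.2
          (congrArg Subtype.val hfg) h).elim hx hy
      smul_mem' := fun c x hx => by
        obtain ⟨X, hX, g, f, rfl, rfl, hfg⟩ := R.exists_common₂ c x
        rw [smul_eq_mul, R.mk_mul_mk]
        exact fun h => hx (P.1.trW_left_of_trW_mul
          (TensorMultiplicativeSet.not_prop_of_mem P hX) _ _ f.2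
          (congrArg Subtype.val hfg.symm) h) }
  isPrime := by
    refine Ideal.isPrime_iff.2 ⟨fun h => ?_, fun {x y} h => ?_⟩
    · have h1 := (Ideal.eq_top_iff_one _).1 h
      obtain ⟨X, hX⟩ := Φ.nonempty
      rw [← R.mk_one hX] at h1
      exact h1 (P.1.asIdeal.trW.id_mem X)
    · obtain ⟨X, hX, f, g, rfl, rfl, -⟩ := R.exists_common₂ x y
      by_contra! hxy
      rw [R.mk_mul_mk] at h
      exact h (P.1.asIdeal.trW.comp_mem _ _ (not_not.1 hxy.2) (not_not.1 hxy.1))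

theorem mk_mem_comparison_iff (P : Φ.zeroLocus) {X : K} (hX : X ∈ Φ.carrier)
    (f : balancedEnd X) :
    R.mk hX f ∈ (comparison P).asIdeal ↔ ¬ P.1.asIdeal (cone (f : End X)) :=
  (R.notTrW_mk P hX f).trans (not_congr (trW_iff_prop_cone _ _))

/-- The preimage of the basic open set of `[f]` is the trace on `Z_Φ` of `(supp (cone f))ᶜ`. -/
theorem isSpectralMap_comparison : IsSpectralMap (comparison (Φ := Φ)) := by
  have key (x : R Φ) : ∃ a : K, comparison ⁻¹' (PrimeSpectrum.basicOpen x : Set _) =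
      (Subtype.val ⁻¹' (supp a)ᶜ : Set Φ.zeroLocus) := by
    induction x using R.ind with | h X hX f =>
    refine ⟨cone (f : End X), Set.ext fun P => ?_⟩
    exact (not_congr (mk_mem_comparison_iff P hX f)).trans Iff.rfl
  refine isSpectralMap_of_basis PrimeSpectrum.isTopologicalBasis_basic_opens
    PrimeSpectrum.isCompact_basicOpen (fun x => ?_) fun x => ?_ <;> obtain ⟨a, ha⟩ := key x <;>
    rw [ha]
  exacts [Φ.isOpen_supp_compl a, Φ.isCompact_supp_compl a]

end TT

/-! ### Functoriality -/

section Functoriality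

open Functor.LaxMonoidal

variable {K : Type u₁} [Category.{v₁} K] [Preadditive K] [HasZeroObject K] [HasShift K ℤ]
  [∀ n : ℤ, (shiftFunctor K n).Additive] [Pretriangulated K]
  [MonoidalCategory K] [SymmetricCategory K] [TensorTriangulatedCategory K]
  {L : Type u₂} [Category.{v₂} L] [Preadditive L] [HasZeroObject L] [HasShift L ℤ]
  [∀ n : ℤ, (shiftFunctor L n).Additive] [Pretriangulated L]
  [MonoidalCategory L] [SymmetricCategory L] [TensorTriangulatedCategory L]

/-- The isomorphism `μ` intertwines `F f ⊗ F X` with `F (f ⊗ X)`, and likewise on the other side. -/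
theorem map_mem_balancedEnd (F : K ⥤ L) [F.Monoidal] {X : K} (f : X ⟶ X)
    (hf : f ∈ balancedEnd X) : F.map f ∈ balancedEnd (F.obj X) := by
  rw [mem_balancedEnd] at *
  rw [← cancel_mono (μ F X X), μ_natural_left, μ_natural_right, hf]

instance (F : K ⥤ L) [F.CommShift ℤ] [F.Monoidal] [IsTensorTriangulated F] : F.IsTriangulated :=
  IsTensorTriangulated.isTriangulated

variable (F : K ⥤ L) [F.Monoidal]

section Ring

variable {Φ : TensorMultiplicativeSet K} {Ψ : TensorMultiplicativeSet L}
  (hF : ∀ X ∈ Φ.carrier, F.obj X ∈ Ψ.carrier)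

/-- The map `[f] ↦ [F f]`. -/
def R.mapFun : R Φ → R Ψ :=
  Quot.lift (fun r => R.mk (hF r.obj r.mem) ⟨F.map r.hom, map_mem_balancedEnd F _ r.hom_mem⟩) (by
    rintro r _ (⟨a, ha⟩ | ⟨a, ha⟩)
    · refine (R.mk_whiskerLeft (hF a ha) (hF _ r.mem) _
        (whiskerLeft_mem _ _ (map_mem_balancedEnd F _ r.hom_mem))).symm.trans ?_
      exact R.mk_eq_of_iso _ _ (Functor.Monoidal.μIso F a r.obj) _ _ _ _
        (μ_natural_right F a r.hom)
    · refine (R.mk_whiskerRight (hF _ r.mem) (hF a ha) _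
        (whiskerRight_mem _ (map_mem_balancedEnd F _ r.hom_mem) _)).symm.trans ?_
      exact R.mk_eq_of_iso _ _ (Functor.Monoidal.μIso F r.obj a) _ _ _ _
        (μ_natural_left F r.hom a))

theorem R.mapFun_mk {X : K} (hX : X ∈ Φ.carrier) (f : balancedEnd X) :
    R.mapFun F hF (R.mk hX f) =
      R.mk (hF X hX) ⟨F.map (f : End X), map_mem_balancedEnd F _ f.2⟩ := rfl

variable [F.CommShift ℤ] [IsTensorTriangulated F]

/-- The ring homomorphism `[f] ↦ [F f]`. -/
def R.map : R Φ →+* R Ψ where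
  toFun := R.mapFun F hF
  map_one' := by
    obtain ⟨X, hX⟩ := Φ.nonempty
    rw [← R.mk_one hX, R.mapFun_mk, ← R.mk_one (hF X hX)]
    exact congrArg _ (Subtype.ext (F.map_id X))
  map_zero' := by
    obtain ⟨X, hX⟩ := Φ.nonempty
    rw [← R.mk_zero hX, R.mapFun_mk, ← R.mk_zero (hF X hX)]
    exact congrArg _ (Subtype.ext (F.map_zero X X))
  map_mul' x y := by
    obtain ⟨X, hX, f, g, rfl, rfl, -⟩ := R.exists_common₂ x y
    rw [R.mk_mul_mk, R.mapFun_mk, R.mapFun_mk, R.mapFun_mk, R.mk_mul_mk]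
    exact congrArg _ (Subtype.ext (F.map_comp _ _))
  map_add' x y := by
    obtain ⟨X, hX, f, g, rfl, rfl, -⟩ := R.exists_common₂ x y
    rw [R.mk_add_mk, R.mapFun_mk, R.mapFun_mk, R.mapFun_mk, R.mk_add_mk]
    exact congrArg _ (Subtype.ext F.map_add)

end Ring

variable [F.CommShift ℤ] [IsTensorTriangulated F]

/-- The map `P ↦ F⁻¹(P)` on spectra. -/
def Spc.map (P : Spc L) : Spc K where
  asIdeal := P.asIdeal.inverseImage F
  isPrime :=
    { isTriangulated := inferInstance
      isStableUnderRetracts := ⟨fun r h => P.asIdeal.prop_of_retract (r.map F) h⟩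
      tensor_mem := fun a b h => P.asIdeal.prop_of_iso (Functor.Monoidal.μIso F a b)
        (P.isPrime.tensor_mem _ _ h)
      ne_top := fun h => P.not_prop_tensorUnit
        (P.asIdeal.prop_of_iso (Functor.Monoidal.εIso F).symm
          (show P.asIdeal.inverseImage F (𝟙_ K) from h ▸ trivial))
      mem_or_mem := fun a b h => P.isPrime.mem_or_mem _ _
        (P.asIdeal.prop_of_iso (Functor.Monoidal.μIso F a b).symm h) }

theorem isSpectralMap_spcMap : IsSpectralMap (Spc.map F) :=
  isSpectralMap_of_basis isTopologicalBasis_supp_compl isCompact_supp_compl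
    (fun a => isOpen_supp_compl (F.obj a)) fun a => isCompact_supp_compl (F.obj a)

variable {Φ : TensorMultiplicativeSet K} {Ψ : TensorMultiplicativeSet L}
  (hF : ∀ X ∈ Φ.carrier, F.obj X ∈ Ψ.carrier)

/-- The restriction of `Spc F` to `Z_Ψ → Z_Φ`. -/
def zeroLocusMap (P : Ψ.zeroLocus) : Φ.zeroLocus :=
  ⟨Spc.map F P, Set.mem_iInter₂.2 fun X hX => Set.mem_iInter₂.1 P.2 _ (hF X hX)⟩

theorem isSpectralMap_zeroLocusMap : IsSpectralMap (zeroLocusMap F hF) :=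
  isSpectralMap_of_basis Φ.isTopologicalBasis_supp_compl Φ.isCompact_supp_compl
    (fun a => Ψ.isOpen_supp_compl (F.obj a)) fun a => Ψ.isCompact_supp_compl (F.obj a)

/-- Exactness of `F` gives that `F f` has its cone in `P` exactly when `f` has its cone in `F⁻¹(P)`.
-/
theorem comap_comparison (P : Ψ.zeroLocus) :
    PrimeSpectrum.comap (R.map F hF) (comparison P) = comparison (zeroLocusMap F hF P) := by
  refine PrimeSpectrum.ext (Ideal.ext fun x => ?_)
  induction x using R.ind with | h X hX f =>
  exact not_congr (P.1.asIdeal.inverseImage_trW_iff F (show X ⟶ X from (f : End X))).symm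

end Functoriality

theorem isSpectralMap_comap {A B : Type*} [CommRing A] [CommRing B] (φ : A →+* B) :
    IsSpectralMap (PrimeSpectrum.comap φ) :=
  isSpectralMap_of_basis PrimeSpectrum.isTopologicalBasis_basic_opens
    PrimeSpectrum.isCompact_basicOpen
    (fun a => (PrimeSpectrum.basicOpen (φ a)).isOpen)
    fun a => PrimeSpectrum.isCompact_basicOpen (φ a)

end TensorTriangular

open TensorTriangular in
theorem mainTheorem5
    {K : Type u₁} [Category.{v₁} K] [Preadditive K] [HasZeroObject K] [HasShift K ℤ]
    [∀ n : ℤ, (shiftFunctor K n).Additive] [Pretriangulated K]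
    [MonoidalCategory K] [SymmetricCategory K] [TensorTriangulatedCategory K]
    {L : Type u₂} [Category.{v₂} L] [Preadditive L] [HasZeroObject L] [HasShift L ℤ]
    [∀ n : ℤ, (shiftFunctor L n).Additive] [Pretriangulated L]
    [MonoidalCategory L] [SymmetricCategory L] [TensorTriangulatedCategory L]
    (F : K ⥤ L) [F.CommShift ℤ] [F.Monoidal] [IsTensorTriangulated F]
    (Φ : TensorMultiplicativeSet K) (Ψ : TensorMultiplicativeSet L)
    (hF : ∀ X ∈ Φ.carrier, F.obj X ∈ Ψ.carrier) :
    -- all spaces in the diagram are spectral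
    (SpectralSpace (Spc K) ∧ SpectralSpace (Spc L) ∧ SpectralSpace Φ.zeroLocus ∧
      SpectralSpace Ψ.zeroLocus ∧ SpectralSpace (PrimeSpectrum (R Φ)) ∧
      SpectralSpace (PrimeSpectrum (R Ψ))) ∧
    -- the inclusions `Z_Φ ⊆ Spc K` and `Z_Ψ ⊆ Spc L` are spectral
    IsSpectralMap (Subtype.val : Φ.zeroLocus → Spc K) ∧
    IsSpectralMap (Subtype.val : Ψ.zeroLocus → Spc L) ∧
    ∃ (φ : R Φ →+* R Ψ) (SpcF : Spc L → Spc K) (ZF : Ψ.zeroLocus → Φ.zeroLocus)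
      (ρK : Φ.zeroLocus → PrimeSpectrum (R Φ)) (ρL : Ψ.zeroLocus → PrimeSpectrum (R Ψ)),
      -- the ring homomorphism `φ` is `[f] ↦ [F f]`
      (∀ (X : K) (hX : X ∈ Φ.carrier) (f : balancedEnd X),
        ∃ hf : F.map (f : End X) ∈ balancedEnd (F.obj X),
          φ (R.mk hX f) = R.mk (hF X hX) ⟨F.map (f : End X), hf⟩) ∧
      -- `Spc F` is `P ↦ F⁻¹(P)`
      (∀ P : Spc L, (SpcF P).asIdeal = P.asIdeal.inverseImage F) ∧
      -- the comparison maps are `P ↦ {[f] | cone f ∉ P}`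
      (∀ (P : Φ.zeroLocus) (X : K) (hX : X ∈ Φ.carrier) (f : balancedEnd X),
        R.mk hX f ∈ (ρK P).asIdeal ↔ ¬ P.1.asIdeal (cone (f : End X))) ∧
      (∀ (P : Ψ.zeroLocus) (Y : L) (hY : Y ∈ Ψ.carrier) (g : balancedEnd Y),
        R.mk hY g ∈ (ρL P).asIdeal ↔ ¬ P.1.asIdeal (cone (g : End Y))) ∧
      -- all maps in the diagram are spectral
      IsSpectralMap SpcF ∧ IsSpectralMap ZF ∧ IsSpectralMap ρK ∧ IsSpectralMap ρL ∧
      IsSpectralMap (PrimeSpectrum.comap φ) ∧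
      -- the diagram commutes
      (∀ P : Ψ.zeroLocus, (ZF P : Spc K) = SpcF (P : Spc L)) ∧
      PrimeSpectrum.comap φ ∘ ρL = ρK ∘ ZF := by
  refine ⟨⟨inferInstance, inferInstance, inferInstance, inferInstance, inferInstance,
    inferInstance⟩, Φ.isSpectralMap_val, Ψ.isSpectralMap_val, R.map F hF, Spc.map F,
    zeroLocusMap F hF, comparison, comparison, ?_, fun _ => rfl, ?_, ?_, isSpectralMap_spcMap F,
    isSpectralMap_zeroLocusMap F hF, isSpectralMap_comparison, isSpectralMap_comparison,
    isSpectralMap_comap _, fun _ => rfl, funext (comap_comparison F hF)⟩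
  · exact fun X hX f => ⟨map_mem_balancedEnd F _ f.2, rfl⟩
  · exact fun P X hX f => mk_mem_comparison_iff P hX f
  · exact fun P Y hY g => mk_mem_comparison_iff P hY g
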